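/- **Proposition (Holonomy basis).** Let $\Gamma$ be a finite lattice with non-empty vertex set $\mathcal V$ and oriented links $\mathcal L$ (for instance a finite cubic lattice with smooth or periodic boundary; more generally any finite oriented multigraph without dangling links that has a spanning tree). For a finite set $\iota$ of links let $\mathcal H_\iota=\bigotimes_{l\in\iota}L^2(\mathrm U(1))\cong L^2(\mathrm U(1)^{\iota},\prod_l d\theta_l)$, $\int d\theta_l=2\pi$, and $\mathcal H_{\rm kin}=\mathcal H_{\mathcal L}$. On position states $|e^{i\theta}\rangle_l$ (Dirac normalised, $\langle e^{i\theta}|e^{i\phi}\rangle_l=\delta(\theta-\phi)$) put $U_l|e^{i\theta}\rangle_l=e^{i\theta}|e^{i\theta}\rangle_l$ and $X_l(\lambda)|e^{i\theta}\rangle_l=|e^{i(\theta+\lambda)}\rangle_l$. The gauge transformations are $G(\lambda)=\bigotimes_{l=[v,v']}X_l(\lambda_{v'}-\lambda_v)$, $\lambda\in(\mathbb R/2\pi\mathbb Z)^{\mathcal V}$; $\mathcal H_{\rm phys}\subset\mathcal H_{\rm kin}$ is the subspace of gauge-invariant vectors and $\Pi_{\rm phys}=\int\prod_v\frac{d\lambda_v}{2\pi}\,G(\lambda)$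 is the orthogonal projector onto it. Generalised states are continuous antilinear functionals $\varphi\mapsto\langle\varphi|\kappa\rangle$ on the continuous functions on $\mathrm U(1)^{\iota}$; a vector $\psi$ of $\mathcal H_\iota$ is the generalised state $\varphi\mapsto\langle\varphi,\psi\rangle$, the position state $|\theta\rangle$ is $\varphi\mapsto\overline{\varphi(\theta)}$, and operators act on generalised states by duality. Let $T\subset\mathcal L$ be a spanning tree (any two vertices are joined by a unique path in $T$ that passes no link twice), let $R$ consist of the links in $T$ and $S$ of those not in $T$. For $l=[v,v']\in S$ let $\gamma_l$ be the loop that passes $l$ from $v$ to $v'$ and returns from $v'$ to $v$ on $T$, and let $H_l=\prod_{l'\in\gamma_l}U_{l'}^{\sigma_{l'}}$ be the fundamental holonomy, where $\sigma_{l'}=\pm1$ is the direction in which $\gamma_l$ passes $l'$. Let $$\mathcal R=(2\pi)^{\frac{|\mathcal V|-1}{2}}\big(\langle e^{i0},\dots,e^{i0}|_R\otimes I_S\big)\Pi_{\rm phys},\qquad \mathcal R^\dagger=(2\pi)^{\frac{|\mathcal V|-1}{2}}\,\Pi_{\rm phys}\big(|e^{i0},\dots,e^{i0}\rangle_R\otimes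 I_S\big)$$ be the reduction map at orientation $0$ (on continuous functions) and the inverse reduction map (on generalised states). Then: 1. $\mathcal R^\dagger$ restricts to a unitary map $\mathcal H_S\to\mathcal H_{\rm phys}$, whose inverse is given by $\mathcal R$ on continuous physical states. 2. For every $\theta=(\theta_l)_{l\in S}$, with $h_l=e^{i\theta_l}$, the state $|\{h_l\}\rangle=\mathcal R^\dagger\bigotimes_{l\in S}|e^{i\theta_l}\rangle_l$ is a non-zero gauge-invariant generalised state, and $H_l\,|\{h_l\}\rangle=e^{i\theta_l}\,|\{h_l\}\rangle$ for every $l\in S$. 3. The states $|\{h_l\}\rangle$, $h\in\mathrm U(1)^S$, form an orthonormal basis of $\mathcal H_{\rm phys}$ in the continuous (Dirac) sense with respect to $\prod_{l\in S}d\theta_l$: for every $f\in L^2(\mathrm U(1)^S)$ the weak integral $\psi_f=\int f(\theta)\,|\{e^{i\theta_l}\}\rangle\,d\theta$ exists and is a vector of $\mathcal H_{\rm phys}$; $\langle\psi_f,\psi_g\rangle=\int\overline{f}\,g\,d\theta$ for all $f,g$; and every vector of $\mathcal H_{\rm phys}$ equals $\psi_f$ for some $f$. -/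

import Mathlib

noncomputable section

namespace LatticeQED

open MeasureTheory

instance instFactTwoPiPos : Fact (0 < 2 * Real.pi) := ⟨Real.two_pi_pos⟩

/-- The group `U(1)`, written through the angle `θ ∈ ℝ / 2πℤ` of `e^{iθ}`. Its volume is
`dθ`, of total mass `2π`. -/
abbrev Angle : Type := AddCircle (2 * Real.pi)

/-- The unit complex number `e^{iθ}`. -/
def phase (θ : Angle) : ℂ := (AddCircle.toCircle θ : ℂ)

theorem phase_coe (x : ℝ) : phase (x : Angle) = Complex.exp (x * Complex.I) := by
  have h : (2 * Real.pi / (2 * Real.pi) * x : ℝ) = x := by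
    rw [div_self Real.two_pi_pos.ne', one_mul]
  rw [phase, AddCircle.toCircle_apply_mk, h, Circle.coe_exp]

theorem continuous_phase : Continuous phase :=
  continuous_subtype_val.comp AddCircle.continuous_toCircle

theorem phase_add (x y : Angle) : phase (x + y) = phase x * phase y := by
  simp [phase, AddCircle.toCircle_add]

theorem prod_phase {ι : Type*} [Fintype ι] (x : ι → Angle) :
    ∏ i, phase (x i) = phase (∑ i, x i) := by
  classical
  have (s : Finset ι) : ∏ i ∈ s, phase (x i) = phase (∑ i ∈ s, x i) := by
    induction s using Finset.induction_on with
    | empty => simp [phase]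
    | insert a s ha ih => rw [Finset.prod_insert ha, Finset.sum_insert ha, ih, phase_add]
  exact this _

/-! ### Rotor Hilbert spaces, test functions and kets -/

section Rotors

variable {ι : Type*} [Fintype ι]

/-- Joint angular positions of a family of rotors. -/
abbrev Config (ι : Type*) : Type _ := ι → Angle

/-- The Hilbert space `⨂_{l ∈ ι} L²(U(1))`, realised as `L²(U(1)^ι)` for the product
of the measures `dθ_l`. -/
abbrev RotorSpace (ι : Type*) [Fintype ι] : Type _ :=
  Lp ℂ 2 (volume : Measure (Config ι))

/-- Test wave functions: continuous functions on `U(1)^ι`. -/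
abbrev TestSpace (ι : Type*) : Type _ := C(Config ι, ℂ)

/-- A test function as a vector of the Hilbert space. -/
def toVec : TestSpace ι →L[ℂ] RotorSpace ι := ContinuousMap.toLp 2 volume ℂ

/-- Generalised (possibly non-normalisable) states `|κ⟩`, in the Gelfand triple
`TestSpace ι ⊆ RotorSpace ι ⊆ Ket ι`. The ket `|κ⟩` is the continuous antilinear functional
`φ ↦ ⟨φ|κ⟩` on test functions. -/
abbrev Ket (ι : Type*) : Type _ := TestSpace ι →L⋆[ℂ] ℂ

/-- A vector `ψ` of the Hilbert space as a generalised state `φ ↦ ⟨φ, ψ⟩`. -/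
def toKet (ψ : RotorSpace ι) : Ket ι := (innerSLFlip ℂ ψ).comp toVec

/-- The position state `⨂_l |e^{iθ_l}⟩`, that is `⟨φ|θ⟩ = conj (φ θ)`. For the measure
`∏_l dθ_l` it has the normalisation `⟨θ|θ'⟩ = ∏_l δ(θ_l - θ'_l)`. -/
def positionKet (θ : Config ι) : Ket ι :=
  (starL ℂ : ℂ ≃L⋆[ℂ] ℂ).toContinuousLinearMap.comp (ContinuousMap.evalCLM ℂ θ)

/-- The extension of an operator to generalised states: if `B` is the restriction to test
functions of the adjoint of `A`, then `⟨φ|A κ⟩ = ⟨B φ|κ⟩`. -/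
def dualOp {κ : Type*} (B : TestSpace ι →L[ℂ] TestSpace κ) : Ket κ →ₗ[ℂ] Ket ι where
  toFun k := k.comp B
  map_add' _ _ := rfl
  map_smul' _ _ := rfl

/-- The function `θ ↦ e^{iθ_l}`. -/
def phaseFun (l : ι) : TestSpace ι where
  toFun θ := phase (θ l)
  continuous_toFun := continuous_phase.comp (continuous_apply l)

/-- The link operator `U_l`, with `U_l |e^{iθ}⟩ = e^{iθ_l} |e^{iθ}⟩`, on generalised states
(its adjoint multiplies test functions by `e^{-iθ_l}`). -/
def linkOp (l : ι) : Module.End ℂ (Ket ι) :=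
  dualOp (ContinuousLinearMap.mul ℂ (TestSpace ι) (star (phaseFun l)))

/-- The adjoint `U_l† = U_l⁻¹` of the link operator on generalised states. -/
def linkOpAdj (l : ι) : Module.End ℂ (Ket ι) :=
  dualOp (ContinuousLinearMap.mul ℂ (TestSpace ι) (phaseFun l))

/-- Restriction of test functions to the positions `r` of a subset of the rotors: the bra
`⟨e^{i r}|_R ⊗ I_S` for the rotors `R = {l | l ∈ T}` and `S = {l | l ∉ T}`. -/
def braFrame [DecidableEq ι] (T : Finset ι) (r : Config {l // l ∈ T}) :
    TestSpace ι →L[ℂ] TestSpace {l // l ∉ T} where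
  toFun φ := φ.comp
    ⟨fun s => (Homeomorph.piEquivPiSubtypeProd (· ∈ T) (fun _ => Angle)).symm (r, s), by fun_prop⟩
  map_add' _ _ := rfl
  map_smul' _ _ := rfl
  cont := ContinuousMap.continuous_precomp _

/-- The map `|e^{i r}⟩_R ⊗ I_S`, inserting the frame rotors in the position state `r`. -/
def ketFrame [DecidableEq ι] (T : Finset ι) (r : Config {l // l ∈ T}) :
    Ket {l // l ∉ T} →ₗ[ℂ] Ket ι :=
  dualOp (braFrame T r)

/-- `ψ = ∫ f(x) |e x⟩ dμ(x)`, in the weak sense. -/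
def IsSuperposition {X : Type*} [MeasurableSpace X] (μ : Measure X) (e : X → Ket ι)
    (f : Lp ℂ 2 μ) (ψ : RotorSpace ι) : Prop :=
  ∀ φ : TestSpace ι, Integrable (fun x => f x * e x φ) μ ∧
    toKet ψ φ = ∫ x, f x * e x φ ∂μ

/-- The kets `|e x⟩`, with labels `x` in the measure space `(X, μ)`, form an orthonormal basis
of the subspace `K` in the continuous (Dirac) sense: square-integrable superpositions of them
exist and lie in `K`, `⟨e x|e y⟩ = δ(x, y)` with respect to `μ` after smearing with
square-integrable functions, and every vector of `K` is such a superposition. -/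
structure IsDiracOrthonormalBasis {X : Type*} [MeasurableSpace X] (μ : Measure X)
    (K : Submodule ℂ (RotorSpace ι)) (e : X → Ket ι) : Prop where
  superposition_mem : ∀ f : Lp ℂ 2 μ, ∃ ψ ∈ K, IsSuperposition μ e f ψ
  orthonormal : ∀ (f g : Lp ℂ 2 μ) (ψ χ : RotorSpace ι), IsSuperposition μ e f ψ →
    IsSuperposition μ e g χ → inner ℂ ψ χ = ∫ x, star (f x) * g x ∂μ
  complete : ∀ ψ ∈ K, ∃ f : Lp ℂ 2 μ, IsSuperposition μ e f ψ

end Rotors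

/-! ### Lattices, loops and spanning trees -/

/-- A lattice with vertices `V` and oriented links `L`; the link `l` is `[src l, tgt l]`. All
links have both ends in the lattice, so there are no dangling links. -/
structure Lattice (V L : Type*) where
  src : L → V
  tgt : L → V

namespace Lattice

variable {V L : Type*} (Γ : Lattice V L)

/-- Initial vertex of a step: a link passed in the positive (`true`) or negative (`false`)
direction. -/
def stepStart (s : L × Bool) : V := if s.2 then Γ.src s.1 else Γ.tgt s.1

/-- Final vertex of a step. -/
def stepEnd (s : L × Bool) : V := if s.2 then Γ.tgt s.1 else Γ.src s.1

/-- `γ` is a walk from `v` to `w`. -/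
def IsWalk : V → V → List (L × Bool) → Prop
  | v, w, [] => v = w
  | v, w, s :: γ => Γ.stepStart s = v ∧ IsWalk (Γ.stepEnd s) w γ

/-- `γ` is a path from `v` to `w` in the set of links `T`, passing no link more than once. -/
def IsPathIn (T : Finset L) (v w : V) (γ : List (L × Bool)) : Prop :=
  Γ.IsWalk v w γ ∧ (γ.map Prod.fst).Nodup ∧ ∀ s ∈ γ, s.1 ∈ T

/-- `T` is (the set of links of) a spanning tree: any two vertices are connected by a unique
path in `T`. In particular (`v = w`) there are no loops in `T`. -/
def IsSpanningTree (T : Finset L) : Prop :=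
  ∀ v w : V, ∃! γ : List (L × Bool), Γ.IsPathIn T v w γ

variable {Γ} in
/-- The path from `v` to `w` on the spanning tree. -/
def IsSpanningTree.path {T : Finset L} (hT : Γ.IsSpanningTree T) (v w : V) : List (L × Bool) :=
  (hT v w).choose

variable {Γ} in
/-- The loop `γ_l` closed by the link `l = [v, v']`: pass `l` from `v` to `v'`, then go from
`v'` back to `v` on the spanning tree. -/
def IsSpanningTree.fundamentalLoop {T : Finset L} (hT : Γ.IsSpanningTree T) (l : L) :
    List (L × Bool) :=
  (l, true) :: hT.path (Γ.tgt l) (Γ.src l)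

/-- The Wilson line (holonomy operator if `γ` is a loop) `∏_{l ∈ γ} U_l^{σ_l}`. -/
def wilson [Fintype L] (γ : List (L × Bool)) : Module.End ℂ (Ket L) :=
  (γ.map fun s => if s.2 then linkOp s.1 else linkOpAdj s.1).prod

/-! ### Gauge transformations and physical states -/

/-- The lattice gradient `(dλ)_l = λ_{v'} - λ_v` for `l = [v, v']`. -/
def grad (lam : V → Angle) : Config L := fun l => lam (Γ.tgt l) - lam (Γ.src l)

theorem continuous_grad : Continuous Γ.grad := by
  unfold grad; fun_prop

/-- The gauge transformation `G(λ) = ∏_v e^{iλ_v C_v} = ⨂_{l = [v, v']} X_l(λ_{v'} - λ_v)` on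
test functions, where `X_l(α) |e^{iθ}⟩_l = |e^{i(θ + α)}⟩_l`. -/
def gaugeTest (lam : V → Angle) : TestSpace L →L[ℂ] TestSpace L where
  toFun φ := φ.comp ⟨fun θ => θ - Γ.grad lam, by fun_prop⟩
  map_add' _ _ := rfl
  map_smul' _ _ := rfl
  cont := ContinuousMap.continuous_precomp _

/-- The electric flux state `⨂_l |k_l⟩`, up to the factor `(2π)^{-|L|/2}`. -/
def fluxFun [Fintype L] (k : L → ℤ) : TestSpace L where
  toFun θ := ∏ l, fourier (k l) (θ l)
  continuous_toFun := by fun_prop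

/-- On electric flux states, `G(λ)` is `∏_v e^{iλ_v C_v}` for the Gauss constraints
`C_v = ∑_{l out of v} ε_l - ∑_{l into v} ε_l`. -/
theorem gaugeTest_fluxFun [Fintype V] [Fintype L] [DecidableEq V] (lam : V → Angle) (k : L → ℤ) :
    Γ.gaugeTest lam (fluxFun k) =
      (∏ v, fourier ((∑ l with Γ.src l = v, k l) - ∑ l with Γ.tgt l = v, k l) (lam v)) •
        fluxFun k := by
  have key (f : L → V) : ∑ l, k l • lam (f l) = ∑ v, (∑ l with f l = v, k l) • lam v := by
    rw [← Finset.sum_fiberwise (s := Finset.univ) (g := f)]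
    refine Finset.sum_congr rfl fun v _ => ?_
    rw [Finset.sum_smul]
    refine Finset.sum_congr rfl fun l hl => ?_
    rw [(Finset.mem_filter.1 hl).2]
  ext θ
  change ∏ l, phase (k l • (θ l - Γ.grad lam l)) =
    (∏ v, phase (((∑ l with Γ.src l = v, k l) - ∑ l with Γ.tgt l = v, k l) • lam v)) *
      ∏ l, phase (k l • θ l)
  rw [prod_phase, prod_phase, prod_phase, ← phase_add]
  congr 1
  simp only [grad, smul_sub, sub_smul, Finset.sum_sub_distrib, ← key]
  abel

/-- The gauge transformation `G(λ)` on generalised states. -/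
def gaugeKet [Fintype L] (lam : V → Angle) : Module.End ℂ (Ket L) :=
  dualOp (Γ.gaugeTest (-lam))

/-- The gauge transformation `G(λ)` on the kinematical Hilbert space. -/
def gaugeVec [Fintype L] (lam : V → Angle) : RotorSpace L →ₗᵢ[ℂ] RotorSpace L :=
  Lp.compMeasurePreservingₗᵢ ℂ (fun θ => θ - Γ.grad lam)
    (measurePreserving_sub_right volume (Γ.grad lam))

/-- The physical Hilbert space: the gauge-invariant vectors. -/
def physSpace [Fintype L] : Submodule ℂ (RotorSpace L) :=
  ⨅ lam : V → Angle, LinearMap.eqLocus (Γ.gaugeVec lam).toLinearMap LinearMap.id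

theorem integrable_orbit [Fintype V] (φ : TestSpace L) (θ : Config L) :
    Integrable (fun lam : V → Angle => φ (θ - Γ.grad lam)) := by
  have := Γ.continuous_grad
  have h : Continuous fun lam : V → Angle => φ (θ - Γ.grad lam) := by fun_prop
  exact h.integrable_of_hasCompactSupport (HasCompactSupport.of_compactSpace _)

theorem volume_real_univ (ι : Type*) [Fintype ι] :
    (volume : Measure (ι → Angle)).real Set.univ = (2 * Real.pi) ^ Fintype.card ι := by
  rw [Measure.real, volume_pi, Measure.pi_univ]
  simp [AddCircle.measure_univ, ENNReal.toReal_ofReal Real.pi_pos.le]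

/-- The projector `Π_phys = ∏_v (∫ dλ_v / 2π e^{iλ_v C_v})` on test functions. -/
def physProj [Fintype V] [Fintype L] : TestSpace L →L[ℂ] TestSpace L :=
  LinearMap.mkContinuous
    { toFun := fun φ =>
        { toFun := fun θ => (((2 * Real.pi) ^ Fintype.card V : ℝ) : ℂ)⁻¹ *
            ∫ lam : V → Angle, φ (θ - Γ.grad lam)
          continuous_toFun := by
            have := Γ.continuous_grad
            refine continuous_const.mul ?_
            simpa using continuous_parametric_integral_of_continuous
              (μ := (volume : Measure (V → Angle))) (s := Set.univ)
              (f := fun θ lam => φ (θ - Γ.grad lam)) (by fun_prop) isCompact_univ }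
      map_add' := fun φ φ' => by
        ext θ
        simp [integral_add (Γ.integrable_orbit φ θ) (Γ.integrable_orbit φ' θ), mul_add]
      map_smul' := fun c φ => by
        ext θ
        simp [integral_const_mul, mul_left_comm] }
    1 (fun φ => by
      rw [one_mul]
      refine (ContinuousMap.norm_le _ (norm_nonneg _)).2 fun θ => ?_
      have h := norm_integral_le_of_norm_le_const (μ := (volume : Measure (V → Angle)))
        (Filter.Eventually.of_forall fun lam => φ.norm_coe_le_norm (θ - Γ.grad lam))
      rw [volume_real_univ] at h
      have hp : 0 < (2 * Real.pi) ^ Fintype.card V := pow_pos Real.two_pi_pos _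
      simp only [LinearMap.coe_mk, AddHom.coe_mk, ContinuousMap.coe_mk, norm_mul, norm_inv,
        Complex.norm_real, Real.norm_eq_abs, abs_of_pos hp]
      rw [inv_mul_le_iff₀ hp]
      exact h.trans_eq (mul_comm _ _))

theorem physProj_apply [Fintype V] [Fintype L] (φ : TestSpace L) (θ : Config L) :
    Γ.physProj φ θ = (((2 * Real.pi) ^ Fintype.card V : ℝ) : ℂ)⁻¹ *
      ∫ lam : V → Angle, φ (θ - Γ.grad lam) := rfl

theorem grad_add (lam lam' : V → Angle) :
    Γ.grad (lam + lam') = Γ.grad lam + Γ.grad lam' := by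
  funext l; simp only [grad, Pi.add_apply]; abel

theorem mem_physSpace [Fintype L] (ψ : RotorSpace L) :
    ψ ∈ Γ.physSpace ↔ ∀ lam : V → Angle, Γ.gaugeVec lam ψ = ψ := by
  simp [physSpace, Submodule.mem_iInf, LinearMap.mem_eqLocus]

theorem gaugeVec_toVec [Fintype L] (lam : V → Angle) (φ : TestSpace L) :
    Γ.gaugeVec lam (toVec φ) = toVec (Γ.gaugeTest lam φ) := by
  have hm := measurePreserving_sub_right (volume : Measure (Config L)) (Γ.grad lam)
  refine Lp.ext ?_
  refine (Lp.coeFn_compMeasurePreserving (toVec φ) hm).trans ?_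
  refine (hm.quasiMeasurePreserving.ae_eq_comp (ContinuousMap.coeFn_toLp volume φ)).trans ?_
  exact (ContinuousMap.coeFn_toLp (p := 2) (𝕜 := ℂ) volume (Γ.gaugeTest lam φ)).symm

instance [Fintype L] : CompleteSpace Γ.physSpace := by
  refine IsClosed.completeSpace_coe (hs := ?_)
  have : (Γ.physSpace : Set (RotorSpace L)) =
      ⋂ lam : V → Angle, {ψ | Γ.gaugeVec lam ψ = ψ} := by
    ext ψ; simp [mem_physSpace]
  rw [this]
  exact isClosed_iInter fun lam => isClosed_eq (Γ.gaugeVec lam).continuous continuous_id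

theorem gaugeTest_physProj [Fintype V] [Fintype L] (lam : V → Angle) (φ : TestSpace L) :
    Γ.gaugeTest lam (Γ.physProj φ) = Γ.physProj φ := by
  ext θ
  change Γ.physProj φ (θ - Γ.grad lam) = _
  rw [physProj_apply, physProj_apply]
  congr 1
  rw [← integral_add_left_eq_self (fun mu => φ (θ - Γ.grad mu)) lam]
  simp only [grad_add, sub_sub]

theorem continuous_gaugeTest [Fintype V] [Fintype L] (φ : TestSpace L) :
    Continuous fun lam : V → Angle => Γ.gaugeTest lam φ := by
  have := Γ.continuous_grad
  exact (ContinuousMap.curry (X := V → Angle) (Y := Config L)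
    ⟨fun p => φ (p.2 - Γ.grad p.1), by fun_prop⟩).continuous

theorem physProj_eq_integral [Fintype V] [Fintype L] (φ : TestSpace L) :
    Γ.physProj φ = (((2 * Real.pi) ^ Fintype.card V : ℝ) : ℂ)⁻¹ •
      ∫ lam : V → Angle, Γ.gaugeTest lam φ := by
  ext θ
  rw [physProj_apply, ContinuousMap.smul_apply, ContinuousMap.integral_apply
    ((Γ.continuous_gaugeTest φ).integrable_of_hasCompactSupport
      (HasCompactSupport.of_compactSpace _))]
  rfl

/-- `Π_phys` is (the restriction to test functions of) the orthogonal projection onto the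
physical Hilbert space. -/
theorem toVec_physProj [Fintype V] [Fintype L] (φ : TestSpace L) :
    toVec (Γ.physProj φ) = Γ.physSpace.starProjection (toVec φ) := by
  symm
  refine Submodule.eq_starProjection_of_mem_of_inner_eq_zero ?_ ?_
  · rw [mem_physSpace]
    intro lam
    rw [gaugeVec_toVec, gaugeTest_physProj]
  · intro ψ hψ
    rw [mem_physSpace] at hψ
    have hint := (Γ.continuous_gaugeTest φ).integrable_of_hasCompactSupport
      (μ := (volume : Measure (V → Angle))) (HasCompactSupport.of_compactSpace _)
    have h1 : inner ℂ ψ (toVec (∫ lam : V → Angle, Γ.gaugeTest lam φ)) =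
        ∫ lam : V → Angle, inner ℂ ψ (toVec (Γ.gaugeTest lam φ)) :=
      (((innerSL ℂ ψ).comp toVec).integral_comp_comm hint).symm
    have h2 (lam : V → Angle) : inner ℂ ψ (toVec (Γ.gaugeTest lam φ)) =
        inner ℂ ψ (toVec φ) := by
      rw [← gaugeVec_toVec]
      nth_rewrite 1 [← hψ lam]
      exact (Γ.gaugeVec lam).inner_map_map _ _
    have hp : (((2 * Real.pi) ^ Fintype.card V : ℝ) : ℂ) ≠ 0 :=
      Complex.ofReal_ne_zero.2 (pow_pos Real.two_pi_pos _).ne'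
    have h3 : inner ℂ ψ (toVec (Γ.physProj φ)) = inner ℂ ψ (toVec φ) := by
      rw [physProj_eq_integral, map_smul, inner_smul_right, h1]
      simp only [h2]
      rw [integral_const, volume_real_univ, Complex.real_smul, inv_mul_cancel_left₀ hp]
    rw [← inner_conj_symm, inner_sub_right, h3, sub_self, map_zero]

/-! ### The reduction map -/

/-- The factor `(2π)^{(|V|-1)/2}`. -/
def reductionFactor (V : Type*) [Fintype V] : ℝ :=
  (2 * Real.pi) ^ (((Fintype.card V : ℝ) - 1) / 2)

/-- The reduction map `R^λ = (2π)^{(|V|-1)/2} (⟨φ(λ)|_R ⊗ I_S) Π_phys` of the frame `R = T` at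
orientation `|φ(λ)⟩_R = ⨂_{l ∈ T} |e^{iλ_l}⟩_l`, on test functions. -/
def reduction [Fintype V] [Fintype L] [DecidableEq L] (T : Finset L)
    (lam : Config {l // l ∈ T}) : TestSpace L →L[ℂ] TestSpace {l // l ∉ T} :=
  (reductionFactor V : ℂ) • (braFrame T lam).comp Γ.physProj

/-- The inverse reduction map `(R^λ)† = (2π)^{(|V|-1)/2} Π_phys (|φ(λ)⟩_R ⊗ I_S)`, on
generalised states. -/
def invReduction [Fintype V] [Fintype L] [DecidableEq L] (T : Finset L)
    (lam : Config {l // l ∈ T}) : Ket {l // l ∉ T} →ₗ[ℂ] Ket L :=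
  (reductionFactor V : ℂ) • dualOp Γ.physProj ∘ₗ ketFrame T lam

/-- The holonomy state `|{h_l}⟩ = (R^0)† ⨂_{l ∉ T} |e^{iθ_l}⟩_l` with labels `h_l = e^{iθ_l}`. -/
def holonomyKet [Fintype V] [Fintype L] [DecidableEq L] (T : Finset L)
    (θ : Config {l // l ∉ T}) : Ket L :=
  Γ.invReduction T 0 (positionKet θ)

end Lattice

end LatticeQED

end

noncomputable section

namespace LatticeQED

open MeasureTheory

/-! ### Test functions, vectors and kets. -/

section Rotors

variable {ι : Type*} [Fintype ι]

/-! The angles of the fundamental holonomies form a continuous surjective homomorphism `h` from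
`U(1)^L` to `U(1)^S`. It is constant on gauge orbits, and every configuration can be gauged to the
one that is trivial on `T` and has the same holonomies (`exists_frameExtend_sub_grad`). Hence
gauge-invariant functions are the functions of `h`.

Such a homomorphism sends Haar measure to a multiple of Haar measure; comparing total masses gives
`(2π)^|T|`, and `|T| = |V| - 1` by `card_vertices`. So `J f = (2π)^{-(|V|-1)/2} f ∘ h` is an
isometry into the physical space. On test functions `J R = Π_phys`, from which `J` is the adjoint of
`R` (`inner_holonomyIsometry`) and is onto (`exists_holonomyIsometry_eq`): `J` is the inverse
reduction map on vectors.

The ket of `θ` sends `φ` to the conjugate of `(R φ)(θ)`. Its weak superposition with coefficients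
`f` is therefore `J f`, and the Dirac basis property is the unitarity of `J`. The eigenvalue
equation holds because the phase of a holonomy passes through the gauge average. -/

theorem denseRange_toVec : DenseRange (toVec : TestSpace ι →L[ℂ] RotorSpace ι) :=
  ContinuousMap.toLp_denseRange ℂ volume ℂ (by simp)

theorem toKet_apply (ψ : RotorSpace ι) (φ : TestSpace ι) :
    toKet ψ φ = inner ℂ (toVec φ) ψ := rfl

theorem toKet_injective : Function.Injective (toKet : RotorSpace ι → Ket ι) := by
  intro ψ χ h
  refine denseRange_toVec.eq_of_inner_right ℂ ?_
  rintro φ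
  exact DFunLike.congr_fun h φ

theorem volume_univ_config (ι : Type*) [Fintype ι] :
    (volume : Measure (Config ι)) Set.univ = ENNReal.ofReal (2 * Real.pi) ^ Fintype.card ι := by
  rw [volume_pi, Measure.pi_univ]
  simp [AddCircle.measure_univ]

end Rotors

theorem phase_neg (x : Angle) : phase (-x) = star (phase x) := by
  rw [phase, AddCircle.toCircle_neg, Circle.coe_inv_eq_conj]
  rfl

namespace Lattice

/-! ### Sums along walks -/

section WalkSum

variable {V L G : Type*} [AddCommGroup G]

/-- The sum of the signed link values `±τ_l` along a walk. -/
def walkSum (τ : L → G) (γ : List (L × Bool)) : G :=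
  (γ.map fun s => if s.2 then τ s.1 else -τ s.1).sum

@[simp]
theorem walkSum_nil (τ : L → G) : walkSum τ [] = 0 := rfl

theorem walkSum_cons (τ : L → G) (s : L × Bool) (γ : List (L × Bool)) :
    walkSum τ (s :: γ) = (if s.2 then τ s.1 else -τ s.1) + walkSum τ γ := by
  simp [walkSum]

theorem walkSum_zero (γ : List (L × Bool)) : walkSum (0 : L → G) γ = 0 := by
  induction γ with
  | nil => rfl
  | cons s γ ih => simp [walkSum_cons, ih]

theorem walkSum_add (τ τ' : L → G) (γ : List (L × Bool)) :
    walkSum (τ + τ') γ = walkSum τ γ + walkSum τ' γ := by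
  induction γ with
  | nil => simp
  | cons s γ ih =>
    rw [walkSum_cons, walkSum_cons, walkSum_cons, ih]
    cases s.2 <;> simp <;> abel

theorem walkSum_congr {τ τ' : L → G} {γ : List (L × Bool)} (h : ∀ s ∈ γ, τ s.1 = τ' s.1) :
    walkSum τ γ = walkSum τ' γ := by
  unfold walkSum
  congr 1
  exact List.map_congr_left fun s hs => by rw [h s hs]

/-- The sum of a gradient along a walk telescopes. -/
theorem IsWalk.walkSum_eq_sub {Γ : Lattice V L} (lam : V → G) {τ : L → G} {v w : V}
    {γ : List (L × Bool)} (hγ : Γ.IsWalk v w γ)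
    (hτ : ∀ s ∈ γ, τ s.1 = lam (Γ.tgt s.1) - lam (Γ.src s.1)) :
    walkSum τ γ = lam w - lam v := by
  induction γ generalizing v with
  | nil => cases hγ; simp
  | cons s γ ih =>
    obtain ⟨rfl, hγ⟩ := hγ
    rw [walkSum_cons, ih hγ fun s hs => hτ s (List.mem_cons_of_mem _ hs),
      hτ s List.mem_cons_self]
    rcases s with ⟨l, _ | _⟩ <;> simp [stepStart, stepEnd]

end WalkSum

/-! ### Spanning trees -/

section Tree

variable {V L : Type*} {Γ : Lattice V L} {T : Finset L}

theorem IsWalk.of_append {v w : V} {s : L × Bool} {γ₁ γ₂ : List (L × Bool)}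
    (h : Γ.IsWalk v w (γ₁ ++ s :: γ₂)) : Γ.IsWalk (Γ.stepStart s) w (s :: γ₂) := by
  induction γ₁ generalizing v with
  | nil => exact ⟨rfl, h.2⟩
  | cons t γ ih => exact ih h.2

theorem IsPathIn.of_append {v w : V} {s : L × Bool} {γ₁ γ₂ : List (L × Bool)}
    (h : Γ.IsPathIn T v w (γ₁ ++ s :: γ₂)) : Γ.IsPathIn T (Γ.stepStart s) w (s :: γ₂) := by
  refine ⟨h.1.of_append, ?_, fun t ht => h.2.2 t (List.mem_append_right _ ht)⟩
  have := h.2.1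
  rw [List.map_append] at this
  exact this.of_append_right

theorem IsPathIn.tail {v w : V} {s : L × Bool} {γ : List (L × Bool)}
    (h : Γ.IsPathIn T v w (s :: γ)) : Γ.IsPathIn T (Γ.stepEnd s) w γ :=
  ⟨h.1.2, (List.nodup_cons.1 h.2.1).2, fun t ht => h.2.2 t (List.mem_cons_of_mem _ ht)⟩

theorem IsSpanningTree.isPathIn_path (hT : Γ.IsSpanningTree T) (v w : V) :
    Γ.IsPathIn T v w (hT.path v w) :=
  (hT v w).choose_spec.1

theorem IsSpanningTree.eq_path (hT : Γ.IsSpanningTree T) {v w : V} {γ : List (L × Bool)}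
    (h : Γ.IsPathIn T v w γ) : γ = hT.path v w :=
  (hT v w).unique h (hT.isPathIn_path v w)

theorem IsSpanningTree.path_self (hT : Γ.IsSpanningTree T) (v : V) : hT.path v v = [] :=
  (hT.eq_path ⟨show Γ.IsWalk v v [] from rfl, by simp, by simp⟩).symm

/-- The paths on the tree from the two ends of a link of the tree to a third vertex differ by
this link. -/
theorem IsSpanningTree.path_src_or_path_tgt (hT : Γ.IsSpanningTree T) {l : L} (hl : l ∈ T)
    (w : V) : hT.path (Γ.src l) w = (l, true) :: hT.path (Γ.tgt l) w ∨
      hT.path (Γ.tgt l) w = (l, false) :: hT.path (Γ.src l) w := by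
  have hp := hT.isPathIn_path (Γ.tgt l) w
  by_cases hmem : l ∈ (hT.path (Γ.tgt l) w).map Prod.fst
  · obtain ⟨⟨l', b⟩, hs, rfl⟩ := List.mem_map.1 hmem
    obtain ⟨γ₁, γ₂, hγ⟩ := List.append_of_mem hs
    rw [hγ] at hp
    have h1 := hp.of_append
    -- By uniqueness, the part of the path that starts with `l` and the part after `l` are both tree
    -- paths. Passed backwards, `l` starts at `tgt l`, which gives the second alternative. Passed
    -- forwards, it ends at `tgt l`, so the part after it would be the whole path, contradicting its
    -- length.
    cases b with
    | false =>
      right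
      exact (hT.eq_path h1).symm.trans (congrArg _ (hT.eq_path h1.tail))
    | true =>
      have h2 := congrArg List.length ((hT.eq_path h1.tail).trans hγ)
      simp at h2
      omega
  · left
    refine (hT.eq_path ⟨show Γ.IsWalk _ w ((l, true) :: _) from ⟨rfl, hp.1⟩, ?_, ?_⟩).symm
    · exact List.nodup_cons.2 ⟨hmem, hp.2.1⟩
    · rintro s hs
      rcases List.mem_cons.1 hs with rfl | hs
      exacts [hl, hp.2.2 s hs]

/-- Every assignment of group elements to the links of a spanning tree is a gradient. -/
theorem IsSpanningTree.exists_grad_eq {G : Type*} [AddCommGroup G] (hT : Γ.IsSpanningTree T)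
    (w : V) (τ : L → G) :
    ∃ lam : V → G, lam w = 0 ∧ ∀ l ∈ T, lam (Γ.tgt l) - lam (Γ.src l) = τ l := by
  -- A potential vanishing at `w` is forced by telescoping to be minus the sum along the tree path
  -- from `v` to `w`.
  refine ⟨fun v => -walkSum τ (hT.path v w), by simp [hT.path_self], fun l hl => ?_⟩
  rcases hT.path_src_or_path_tgt hl w with h | h <;> simp [h, walkSum_cons]

/-- Potentials with values in `ZMod 2` correspond bijectively to their gradient on `T` together with
their value at one vertex; counting gives `2^|V| = 2^(|T|+1)`. -/
theorem IsSpanningTree.card_vertices [Fintype V] [Nonempty V] (hT : Γ.IsSpanningTree T) :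
    Fintype.card V = T.card + 1 := by
  classical
  obtain ⟨w⟩ := ‹Nonempty V›
  let F : (V → ZMod 2) → ({l // l ∈ T} → ZMod 2) × ZMod 2 := fun lam =>
    (fun l => lam (Γ.tgt l) - lam (Γ.src l), lam w)
  have hF : Function.Bijective F := by
    constructor
    · intro lam mu h
      simp only [F, Prod.mk.injEq] at h
      funext v
      have hp := hT.isPathIn_path w v
      have key := hp.1.walkSum_eq_sub (τ := fun l => lam (Γ.tgt l) - lam (Γ.src l)) lam fun _ _ => rfl
      rw [hp.1.walkSum_eq_sub mu fun s hs => congrFun h.1 ⟨s.1, hp.2.2 s hs⟩, h.2] at key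
      exact (sub_left_inj.1 key).symm
    · rintro ⟨τ, c⟩
      -- The value `0` off `T` is immaterial. The potential found vanishes at `w`, so adding `c`
      -- corrects its value there without changing its gradient.
      obtain ⟨lam, h0, h⟩ := hT.exists_grad_eq w fun l => if hl : l ∈ T then τ ⟨l, hl⟩ else 0
      refine ⟨fun v => lam v + c, ?_⟩
      simp only [F, Prod.mk.injEq, h0, zero_add, and_true]
      funext l
      rw [add_sub_add_right_eq_sub, h l l.2, dif_pos l.2]
  have hc := Fintype.card_of_bijective hF
  simp only [Fintype.card_prod, Fintype.card_fun, ZMod.card, Fintype.card_coe, ← pow_succ] at hc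
  exact Nat.pow_right_injective le_rfl hc

end Tree

/-! ### Fundamental holonomies -/

section Holonomy

variable {V L : Type*} {Γ : Lattice V L} {T : Finset L}

theorem continuous_walkSum (γ : List (L × Bool)) :
    Continuous fun θ : Config L => walkSum θ γ := by
  induction γ with
  | nil => exact continuous_const
  | cons s γ ih =>
    simp only [walkSum_cons]
    rcases s with ⟨l, _ | _⟩ <;> simp only [Bool.false_eq_true, if_true, if_false] <;> fun_prop

/-- The angles of the holonomies around the fundamental loops of a spanning tree. -/
def IsSpanningTree.holonomy (hT : Γ.IsSpanningTree T) : Config L →+ Config {l // l ∉ T} where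
  toFun θ l := walkSum θ (hT.fundamentalLoop l)
  map_zero' := funext fun _ => walkSum_zero _
  map_add' _ _ := funext fun _ => walkSum_add _ _ _

theorem IsSpanningTree.holonomy_apply (hT : Γ.IsSpanningTree T) (θ : Config L)
    (l : {l // l ∉ T}) : hT.holonomy θ l = walkSum θ (hT.fundamentalLoop l) := rfl

theorem IsSpanningTree.continuous_holonomy (hT : Γ.IsSpanningTree T) :
    Continuous hT.holonomy :=
  continuous_pi fun _ => continuous_walkSum _

theorem IsSpanningTree.isWalk_fundamentalLoop (hT : Γ.IsSpanningTree T) (l : L) :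
    Γ.IsWalk (Γ.src l) (Γ.src l) (hT.fundamentalLoop l) :=
  ⟨rfl, (hT.isPathIn_path _ _).1⟩

theorem IsSpanningTree.holonomy_grad (hT : Γ.IsSpanningTree T) (lam : V → Angle) :
    hT.holonomy (Γ.grad lam) = 0 := by
  funext l
  rw [holonomy_apply, (hT.isWalk_fundamentalLoop l).walkSum_eq_sub lam fun _ _ => rfl]
  simp

theorem IsSpanningTree.holonomy_sub_grad (hT : Γ.IsSpanningTree T) (θ : Config L)
    (lam : V → Angle) : hT.holonomy (θ - Γ.grad lam) = hT.holonomy θ := by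
  rw [map_sub, hT.holonomy_grad, sub_zero]

variable [DecidableEq L]

/-- The configuration with trivial position of the links in `T` and position `x` of the
others. -/
def frameExtend (T : Finset L) (x : Config {l // l ∉ T}) : Config L :=
  (Homeomorph.piEquivPiSubtypeProd (· ∈ T) (fun _ => Angle)).symm (0, x)

theorem frameExtend_of_mem (x : Config {l // l ∉ T}) {l : L} (hl : l ∈ T) :
    frameExtend T x l = 0 := by
  simp [frameExtend, hl]

theorem frameExtend_of_notMem (x : Config {l // l ∉ T}) (l : {l // l ∉ T}) :
    frameExtend T x l = x l := by
  simp [frameExtend, l.2]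

/-- The fundamental loop of `l` leaves the tree only at `l`. This section of the holonomy map yields
its surjectivity. -/
theorem IsSpanningTree.holonomy_frameExtend (hT : Γ.IsSpanningTree T)
    (x : Config {l // l ∉ T}) : hT.holonomy (frameExtend T x) = x := by
  funext l
  have h : walkSum (frameExtend T x) (hT.path (Γ.tgt l) (Γ.src l)) = 0 := by
    rw [← walkSum_zero (G := Angle) (hT.path (Γ.tgt l) (Γ.src l))]
    exact walkSum_congr fun s hs =>
      frameExtend_of_mem x ((hT.isPathIn_path (Γ.tgt l) (Γ.src l)).2.2 s hs)
  simp [holonomy_apply, fundamentalLoop, walkSum_cons, h, frameExtend_of_notMem]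

theorem IsSpanningTree.surjective_holonomy (hT : Γ.IsSpanningTree T) :
    Function.Surjective hT.holonomy :=
  fun x => ⟨_, hT.holonomy_frameExtend x⟩

/-- Every configuration can be gauged to the trivial one on a spanning tree. -/
theorem IsSpanningTree.exists_frameExtend_sub_grad [Nonempty V] (hT : Γ.IsSpanningTree T)
    (θ : Config L) :
    ∃ lam : V → Angle, frameExtend T (hT.holonomy θ) = θ - Γ.grad lam := by
  obtain ⟨lam, -, hlam⟩ := hT.exists_grad_eq (Classical.arbitrary V) θ
  refine ⟨lam, ?_⟩
  -- The gauged configuration vanishes on `T`, so it is determined by its values off `T`.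
  have h : frameExtend T (fun l => (θ - Γ.grad lam) l) = θ - Γ.grad lam := by
    funext l
    by_cases hl : l ∈ T
    · rw [frameExtend_of_mem _ hl, Pi.sub_apply, grad, hlam l hl, sub_self]
    · exact frameExtend_of_notMem _ ⟨l, hl⟩
  rw [← hT.holonomy_sub_grad θ lam, ← h, hT.holonomy_frameExtend]

end Holonomy

/-! ### Gauge averages and Wilson lines -/

section Averaging

variable {V L : Type*} [Fintype V] [Fintype L] {Γ : Lattice V L}

theorem physProj_sub_grad (φ : TestSpace L) (θ : Config L) (lam : V → Angle) :
    Γ.physProj φ (θ - Γ.grad lam) = Γ.physProj φ θ :=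
  DFunLike.congr_fun (Γ.gaugeTest_physProj lam φ) θ

/-- A factor constant along the gauge orbit of `θ` comes out of the average. -/
theorem physProj_eq_of_forall {φ φ' : TestSpace L} {c : ℂ} {θ : Config L}
    (h : ∀ lam : V → Angle, φ (θ - Γ.grad lam) = c * φ' (θ - Γ.grad lam)) :
    Γ.physProj φ θ = c * Γ.physProj φ' θ := by
  rw [physProj_apply, physProj_apply]
  simp only [h, integral_const_mul]
  ring

theorem physProj_one : Γ.physProj (1 : TestSpace L) = 1 := by
  ext θ
  rw [physProj_apply]
  simp only [ContinuousMap.one_apply, integral_const, volume_real_univ, Complex.real_smul,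
    mul_one]
  exact inv_mul_cancel₀ (Complex.ofReal_ne_zero.2 (pow_pos Real.two_pi_pos _).ne')

theorem physProj_gaugeTest (lam : V → Angle) (φ : TestSpace L) :
    Γ.physProj (Γ.gaugeTest lam φ) = Γ.physProj φ := by
  ext θ
  rw [physProj_apply, physProj_apply,
    ← integral_add_right_eq_self (fun mu => φ (θ - Γ.grad mu)) lam]
  simp only [grad_add, ← sub_sub]
  rfl

end Averaging

/-- The Wilson line multiplies wave functions by the phase of the walk. -/
theorem wilson_apply {L : Type*} [Fintype L] (γ : List (L × Bool)) (k : Ket L) (φ : TestSpace L) :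
    ∃ φ' : TestSpace L, wilson γ k φ = k φ' ∧
      ∀ θ, φ' θ = star (phase (walkSum θ γ)) * φ θ := by
  induction γ generalizing φ with
  | nil => exact ⟨φ, rfl, fun θ => by simp [phase]⟩
  | cons s γ ih =>
    rcases s with ⟨l, _ | _⟩
    -- The head of the walk acts last on the ket, hence first on the test function.
    · obtain ⟨φ', h, h'⟩ := ih (phaseFun l * φ)
      refine ⟨φ', h, fun θ => ?_⟩
      rw [h', walkSum_cons, phase_add]
      simp [phase_neg, phaseFun]
      ring
    · obtain ⟨φ', h, h'⟩ := ih (star (phaseFun l) * φ)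
      refine ⟨φ', h, fun θ => ?_⟩
      rw [h', walkSum_cons, phase_add]
      simp [phaseFun]
      ring

theorem reductionFactor_pos (V : Type*) [Fintype V] : 0 < reductionFactor V :=
  Real.rpow_pos_of_pos Real.two_pi_pos _

theorem IsSpanningTree.reductionFactor_eq {V L : Type*} [Fintype V] [Nonempty V] {Γ : Lattice V L}
    {T : Finset L} (hT : Γ.IsSpanningTree T) :
    reductionFactor V = √((2 * Real.pi) ^ T.card) := by
  rw [reductionFactor, hT.card_vertices, Real.sqrt_eq_rpow, ← Real.rpow_natCast,
    ← Real.rpow_mul Real.two_pi_pos.le]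
  congr 1
  push_cast
  ring

/-! ### The reduction map -/

section Analysis

variable {V L : Type*} [Fintype L] [DecidableEq L] {Γ : Lattice V L} {T : Finset L}

/-- A continuous surjective homomorphism of compact groups carries Haar measure to the Haar measure
of equal total mass; here the masses are `(2π)^|L|` and `(2π)^|T| (2π)^(|L|-|T|)`. -/
theorem IsSpanningTree.measurePreserving_holonomy (hT : Γ.IsSpanningTree T) :
    MeasurePreserving hT.holonomy volume
      (ENNReal.ofReal (2 * Real.pi) ^ T.card • (volume : Measure (Config {l // l ∉ T}))) := by
  have h0 : ENNReal.ofReal (2 * Real.pi) ^ T.card ≠ 0 :=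
    pow_ne_zero _ (ENNReal.ofReal_pos.2 Real.two_pi_pos).ne'
  have h1 : ENNReal.ofReal (2 * Real.pi) ^ T.card ≠ ⊤ := ENNReal.pow_ne_top ENNReal.ofReal_ne_top
  have := Measure.IsAddHaarMeasure.smul (volume : Measure (Config {l // l ∉ T})) h0 h1
  refine AddMonoidHom.measurePreserving hT.continuous_holonomy hT.surjective_holonomy ?_
  rw [Measure.smul_apply, volume_univ_config, volume_univ_config, smul_eq_mul, ← pow_add,
    Fintype.card_subtype_compl, Fintype.card_coe, Nat.add_sub_cancel' (Finset.card_le_univ T)]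

theorem IsSpanningTree.quasiMeasurePreserving_holonomy (hT : Γ.IsSpanningTree T) :
    Measure.QuasiMeasurePreserving hT.holonomy volume volume :=
  hT.measurePreserving_holonomy.quasiMeasurePreserving.mono_right Measure.smul_absolutelyContinuous

theorem IsSpanningTree.memLp_comp_holonomy (hT : Γ.IsSpanningTree T)
    (f : RotorSpace {l // l ∉ T}) : MemLp (f ∘ hT.holonomy) 2 (volume : Measure (Config L)) :=
  ((Lp.memLp f).smul_measure
    (ENNReal.pow_ne_top ENNReal.ofReal_ne_top)).comp_measurePreserving hT.measurePreserving_holonomy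

/-- The wave function `f(h)` of the fundamental holonomies, as a vector of the kinematical
Hilbert space. -/
def IsSpanningTree.pullback (hT : Γ.IsSpanningTree T) :
    RotorSpace {l // l ∉ T} →ₗ[ℂ] RotorSpace L where
  toFun f := (hT.memLp_comp_holonomy f).toLp _
  map_add' f g := by
    rw [← MemLp.toLp_add]
    exact (MemLp.toLp_eq_toLp_iff _ _).2
      (hT.quasiMeasurePreserving_holonomy.ae_eq_comp (Lp.coeFn_add f g))
  map_smul' c f := by
    rw [RingHom.id_apply, ← MemLp.toLp_const_smul]
    exact (MemLp.toLp_eq_toLp_iff _ _).2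
      (hT.quasiMeasurePreserving_holonomy.ae_eq_comp (Lp.coeFn_smul c f))

theorem IsSpanningTree.norm_pullback (hT : Γ.IsSpanningTree T) (f : RotorSpace {l // l ∉ T}) :
    ‖hT.pullback f‖ = √((2 * Real.pi) ^ T.card) * ‖f‖ := by
  change ‖(hT.memLp_comp_holonomy f).toLp _‖ = _
  rw [Lp.norm_toLp, eLpNorm_comp_measurePreserving
    ((Lp.aestronglyMeasurable f).smul_measure _) hT.measurePreserving_holonomy,
    eLpNorm_smul_measure_of_ne_top (by simp), smul_eq_mul, ENNReal.toReal_mul, Lp.norm_def]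
  congr 1
  rw [← ENNReal.toReal_rpow, ENNReal.toReal_pow, ENNReal.toReal_ofReal Real.two_pi_pos.le,
    Real.sqrt_eq_rpow]
  simp

theorem IsSpanningTree.pullback_toVec (hT : Γ.IsSpanningTree T)
    (g : TestSpace {l // l ∉ T}) :
    hT.pullback (toVec g) = toVec (g.comp ⟨hT.holonomy, hT.continuous_holonomy⟩) := by
  refine Lp.ext ((MemLp.coeFn_toLp (hT.memLp_comp_holonomy (toVec g))).trans ?_)
  refine (hT.quasiMeasurePreserving_holonomy.ae_eq_comp
    (ContinuousMap.coeFn_toLp volume g)).trans ?_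
  exact (ContinuousMap.coeFn_toLp (p := 2) (𝕜 := ℂ) volume
    (g.comp ⟨hT.holonomy, hT.continuous_holonomy⟩)).symm

variable [Fintype V]

/-- The isometry `f ↦ (2π)^{-(|V|-1)/2} f(h)`. -/
def IsSpanningTree.holonomyIsometry [Nonempty V] (hT : Γ.IsSpanningTree T) :
    RotorSpace {l // l ∉ T} →ₗᵢ[ℂ] RotorSpace L where
  toLinearMap := (reductionFactor V : ℂ)⁻¹ • hT.pullback
  norm_map' f := by
    rw [LinearMap.smul_apply, norm_smul, hT.norm_pullback, ← hT.reductionFactor_eq, norm_inv,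
      Complex.norm_real, Real.norm_of_nonneg (reductionFactor_pos V).le,
      inv_mul_cancel_left₀ (reductionFactor_pos V).ne']

theorem IsSpanningTree.holonomyIsometry_apply [Nonempty V] (hT : Γ.IsSpanningTree T)
    (f : RotorSpace {l // l ∉ T}) :
    hT.holonomyIsometry f = (reductionFactor V : ℂ)⁻¹ • hT.pullback f := rfl

theorem IsSpanningTree.holonomyIsometry_mem [Nonempty V] (hT : Γ.IsSpanningTree T)
    (f : RotorSpace {l // l ∉ T}) : hT.holonomyIsometry f ∈ Γ.physSpace := by
  rw [mem_physSpace]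
  intro lam
  -- Both sides are continuous in `f`, so test functions suffice, where invariance holds pointwise.
  have key : (fun f => Γ.gaugeVec lam (hT.holonomyIsometry f)) = hT.holonomyIsometry := by
    refine denseRange_toVec.equalizer
      ((Γ.gaugeVec lam).continuous.comp hT.holonomyIsometry.continuous)
      hT.holonomyIsometry.continuous ?_
    funext g
    simp only [Function.comp_apply, hT.holonomyIsometry_apply, map_smul, hT.pullback_toVec,
      gaugeVec_toVec]
    congr 2
    ext θ
    exact congrArg g (hT.holonomy_sub_grad θ lam)
  exact congrFun key f

theorem reduction_zero_apply (φ : TestSpace L) (x : Config {l // l ∉ T}) :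
    Γ.reduction T 0 φ x = reductionFactor V * Γ.physProj φ (frameExtend T x) := rfl

/-- On test functions, the inverse reduction map after the reduction map is the projection onto
physical states. -/
theorem IsSpanningTree.holonomyIsometry_reduction [Nonempty V] (hT : Γ.IsSpanningTree T) (φ : TestSpace L) :
    hT.holonomyIsometry (toVec (Γ.reduction T 0 φ)) = toVec (Γ.physProj φ) := by
  rw [hT.holonomyIsometry_apply, hT.pullback_toVec, ← map_smul]
  congr 1
  ext θ
  -- The average is constant on orbits, so it may be evaluated at the representative that is trivial
  -- on `T`.
  obtain ⟨lam, hlam⟩ := hT.exists_frameExtend_sub_grad θ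
  change (reductionFactor V : ℂ)⁻¹ * Γ.reduction T 0 φ (hT.holonomy θ) = _
  rw [reduction_zero_apply, hlam, physProj_sub_grad,
    inv_mul_cancel_left₀ (Complex.ofReal_ne_zero.2 (reductionFactor_pos V).ne')]

/-- The isometry is the adjoint of the reduction map. -/
theorem IsSpanningTree.inner_holonomyIsometry [Nonempty V] (hT : Γ.IsSpanningTree T) (φ : TestSpace L)
    (f : RotorSpace {l // l ∉ T}) :
    inner ℂ (toVec φ) (hT.holonomyIsometry f) = inner ℂ (toVec (Γ.reduction T 0 φ)) f := by
  rw [← hT.holonomyIsometry.inner_map_map, hT.holonomyIsometry_reduction, toVec_physProj,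
    Submodule.inner_starProjection_left_eq_right,
    Submodule.starProjection_eq_self_iff.2 (hT.holonomyIsometry_mem f)]

/-- The range of an isometry on a complete space is closed, and it contains the projections of the
dense test functions. -/
theorem IsSpanningTree.exists_holonomyIsometry_eq [Nonempty V] (hT : Γ.IsSpanningTree T) {ψ : RotorSpace L}
    (hψ : ψ ∈ Γ.physSpace) : ∃ f, hT.holonomyIsometry f = ψ := by
  have hcl : IsClosed (Set.range hT.holonomyIsometry) :=
    hT.holonomyIsometry.isometry.isClosedEmbedding.isClosed_range
  have key (χ : RotorSpace L) : Γ.physSpace.starProjection χ ∈ Set.range hT.holonomyIsometry := by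
    refine denseRange_toVec.induction_on (p := fun χ => Γ.physSpace.starProjection χ ∈ _) χ
      (hcl.preimage (Γ.physSpace.starProjection).continuous) fun φ => ?_
    rw [← toVec_physProj]
    exact ⟨_, hT.holonomyIsometry_reduction φ⟩
  rw [← Submodule.starProjection_eq_self_iff.2 hψ]
  exact key ψ

/-- The unitary map onto the physical Hilbert space. -/
def IsSpanningTree.holonomyEquiv [Nonempty V] (hT : Γ.IsSpanningTree T) :
    RotorSpace {l // l ∉ T} ≃ₗᵢ[ℂ] Γ.physSpace :=
  LinearIsometryEquiv.ofSurjective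
    { toLinearMap := hT.holonomyIsometry.toLinearMap.codRestrict Γ.physSpace
        hT.holonomyIsometry_mem
      norm_map' := hT.holonomyIsometry.norm_map }
    fun ψ => (hT.exists_holonomyIsometry_eq ψ.2).imp fun _ h => Subtype.ext h

theorem IsSpanningTree.coe_holonomyEquiv [Nonempty V] (hT : Γ.IsSpanningTree T)
    (f : RotorSpace {l // l ∉ T}) :
    (hT.holonomyEquiv f : RotorSpace L) = hT.holonomyIsometry f := rfl

theorem invReduction_apply (k : Ket {l // l ∉ T}) (φ : TestSpace L) :
    Γ.invReduction T 0 k φ = k (Γ.reduction T 0 φ) := by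
  change _ = k ((reductionFactor V : ℂ) • (braFrame T 0 (Γ.physProj φ)))
  rw [map_smulₛₗ, Complex.conj_ofReal]
  rfl

theorem IsSpanningTree.toKet_holonomyIsometry [Nonempty V] (hT : Γ.IsSpanningTree T)
    (f : RotorSpace {l // l ∉ T}) :
    toKet (hT.holonomyIsometry f) = Γ.invReduction T 0 (toKet f) := by
  ext φ
  rw [invReduction_apply, toKet_apply, toKet_apply, hT.inner_holonomyIsometry]

/-! ### Holonomy states -/

theorem holonomyKet_apply (θ : Config {l // l ∉ T}) (φ : TestSpace L) :
    Γ.holonomyKet T θ φ = star (Γ.reduction T 0 φ θ) :=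
  invReduction_apply _ φ

theorem holonomyKet_ne_zero (θ : Config {l // l ∉ T}) : Γ.holonomyKet T θ ≠ 0 := by
  intro h
  -- The constant function `1` is fixed by averaging.
  have h1 := DFunLike.congr_fun h (1 : TestSpace L)
  rw [holonomyKet_apply, reduction_zero_apply, physProj_one] at h1
  simp [(reductionFactor_pos V).ne'] at h1

theorem gaugeKet_holonomyKet (lam : V → Angle) (θ : Config {l // l ∉ T}) :
    Γ.gaugeKet lam (Γ.holonomyKet T θ) = Γ.holonomyKet T θ := by
  ext φ
  change Γ.holonomyKet T θ (Γ.gaugeTest (-lam) φ) = _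
  rw [holonomyKet_apply, holonomyKet_apply, reduction_zero_apply, reduction_zero_apply,
    physProj_gaugeTest]

theorem IsSpanningTree.wilson_holonomyKet (hT : Γ.IsSpanningTree T)
    (θ : Config {l // l ∉ T}) (l : {l // l ∉ T}) :
    wilson (hT.fundamentalLoop l) (Γ.holonomyKet T θ) = phase (θ l) • Γ.holonomyKet T θ := by
  ext φ
  obtain ⟨φ', h, h'⟩ := wilson_apply (hT.fundamentalLoop l) (Γ.holonomyKet T θ) φ
  have key : Γ.physProj φ' (frameExtend T θ) =
      star (phase (θ l)) * Γ.physProj φ (frameExtend T θ) := by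
    refine physProj_eq_of_forall fun lam => ?_
    rw [h', ← hT.holonomy_apply, hT.holonomy_sub_grad, hT.holonomy_frameExtend]
  rw [h, smul_apply, holonomyKet_apply, holonomyKet_apply,
    reduction_zero_apply, reduction_zero_apply, key, smul_eq_mul, mul_left_comm, star_mul',
    star_star]

/-- The integrand is that of the `L²` inner product of `R φ` with `f`, to which adjointness applies.
-/
theorem IsSpanningTree.integrable_and_integral_holonomyKet [Nonempty V] (hT : Γ.IsSpanningTree T)
    (f : RotorSpace {l // l ∉ T}) (φ : TestSpace L) :
    Integrable (fun x => f x * Γ.holonomyKet T x φ) ∧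
      ∫ x, f x * Γ.holonomyKet T x φ = toKet (hT.holonomyIsometry f) φ := by
  have hae : (fun x => inner ℂ (toVec (Γ.reduction T 0 φ) x) (f x)) =ᵐ[volume]
      fun x => f x * Γ.holonomyKet T x φ := by
    filter_upwards [ContinuousMap.coeFn_toLp (p := 2) (𝕜 := ℂ) volume (Γ.reduction T 0 φ)]
      with x hx
    rw [holonomyKet_apply, toVec, hx]
    rfl
  refine ⟨(L2.integrable_inner _ f).congr hae, ?_⟩
  rw [toKet_apply, hT.inner_holonomyIsometry, L2.inner_def, integral_congr_ae hae]

/-- This turns each of the three basis properties into a property of the isometry. -/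
theorem IsSpanningTree.isSuperposition_iff [Nonempty V] (hT : Γ.IsSpanningTree T)
    (f : RotorSpace {l // l ∉ T}) (ψ : RotorSpace L) :
    IsSuperposition volume (Γ.holonomyKet T) f ψ ↔ hT.holonomyIsometry f = ψ := by
  constructor
  · intro h
    refine toKet_injective (ContinuousLinearMap.ext fun φ => ?_)
    rw [(h φ).2, (hT.integrable_and_integral_holonomyKet f φ).2]
  · rintro rfl φ
    have h := hT.integrable_and_integral_holonomyKet f φ
    exact ⟨h.1, h.2.symm⟩

theorem IsSpanningTree.isDiracOrthonormalBasis_holonomyKet [Nonempty V] (hT : Γ.IsSpanningTree T) :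
    IsDiracOrthonormalBasis volume Γ.physSpace (Γ.holonomyKet T) where
  superposition_mem f := ⟨_, hT.holonomyIsometry_mem f, (hT.isSuperposition_iff f _).2 rfl⟩
  orthonormal f g ψ χ hψ hχ := by
    rw [← (hT.isSuperposition_iff f ψ).1 hψ, ← (hT.isSuperposition_iff g χ).1 hχ,
      hT.holonomyIsometry.inner_map_map, L2.inner_def]
    exact integral_congr_ae (Filter.Eventually.of_forall fun x => mul_comm _ _)
  complete ψ hψ :=
    (hT.exists_holonomyIsometry_eq hψ).imp fun f h => (hT.isSuperposition_iff f ψ).2 h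

end Analysis

end Lattice

end LatticeQED

end

theorem mainTheorem5 {V L : Type*} [Fintype V] [Nonempty V] [Fintype L] [DecidableEq L]
    (Γ : LatticeQED.Lattice V L) (T : Finset L) (hT : Γ.IsSpanningTree T) :
    (∃ W : LatticeQED.RotorSpace {l // l ∉ T} ≃ₗᵢ[ℂ] Γ.physSpace,
      (∀ f : LatticeQED.RotorSpace {l // l ∉ T},
        LatticeQED.toKet (W f : LatticeQED.RotorSpace L) =
          Γ.invReduction T 0 (LatticeQED.toKet f)) ∧
      (∀ φ : LatticeQED.TestSpace L, LatticeQED.toVec φ ∈ Γ.physSpace →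
        (W (LatticeQED.toVec (Γ.reduction T 0 φ)) : LatticeQED.RotorSpace L) =
          LatticeQED.toVec φ)) ∧
    (∀ θ : LatticeQED.Config {l // l ∉ T},
      Γ.holonomyKet T θ ≠ 0 ∧
      (∀ lam : V → LatticeQED.Angle, Γ.gaugeKet lam (Γ.holonomyKet T θ) = Γ.holonomyKet T θ) ∧
      (∀ l : {l // l ∉ T},
        LatticeQED.Lattice.wilson (hT.fundamentalLoop l) (Γ.holonomyKet T θ) =
          LatticeQED.phase (θ l) • Γ.holonomyKet T θ)) ∧
    LatticeQED.IsDiracOrthonormalBasis MeasureTheory.volume Γ.physSpace (Γ.holonomyKet T) := by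
  refine ⟨⟨hT.holonomyEquiv, hT.toKet_holonomyIsometry, fun φ hφ => ?_⟩, fun θ => ?_,
    hT.isDiracOrthonormalBasis_holonomyKet⟩
  · rw [hT.coe_holonomyEquiv, hT.holonomyIsometry_reduction, Γ.toVec_physProj,
      Submodule.starProjection_eq_self_iff.2 hφ]
  · exact ⟨LatticeQED.Lattice.holonomyKet_ne_zero θ,
      fun lam => LatticeQED.Lattice.gaugeKet_holonomyKet lam θ, hT.wilson_holonomyKet θ⟩
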